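/- Let $G$ be a non-trivial finite group, regarded as a discrete topological space, and let $P$ be a finite free $G$-poset, i.e. a finite partially ordered set with an order-preserving action of $G$ such that $gp=p$ implies $g=e$. Let $\Delta(P)$ be its order complex (the simplices are the non-empty chains of $P$), with the induced $G$-action, let $\mathrm{sd}^r$ denote the $r$-fold barycentric subdivision ($\mathrm{sd}^0(\mathcal K)=\mathcal K$), and let $\mathcal F(\mathcal K)$ be the face poset of a $G$-simplicial complex $\mathcal K$, i.e. its non-empty simplices ordered by inclusion, with the induced $G$-action. For a $G$-space $X$, the mapping index $\mathrm{ind}\,X$ is the smallest $k\ge 0$ such that there is a continuous $G$-equivariant map $X\to E_kG$, where $E_kG=G^{*(k+1)}$ is the $(k+1)$-fold join of $G$ with the diagonal action. For a $G$-poset $Q$, the cross-index $\mathrm{xind}\,Q$ is the smallest $n\ge 0$ such that there is an order-preserving $G$-equivariant map $Q\to Q_nG$, where $Q_nG=G\times\{0,\dots,n\}$ has the action $g\cdot(h,i)=(gh,i)$ and the order in which $(g,i)\prec(h,j)$ if and only if $i<j$. Both indices are $\infty$ if there is no such integer. Then $\mathrm{ind}\,\Delta(P)$ (the mapping index of the geometric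 realization of $\Delta(P)$) is finite, and there is an $r_0\ge 0$ such that for all $r\ge r_0$ $$\mathrm{xind}\,\mathcal F\bigl(\mathrm{sd}^r(\Delta(P))\bigr)=\mathrm{ind}\,\Delta(P).$$ -/

import Mathlib

universe u v

/-! ### The posets `Q_n G` and the cross-index -/

/-- The ground set `G × {0, …, n}` of the `G`-poset `Q_n G`. -/
@[ext]
structure QPoset (G : Type u) (n : ℕ) where
  elt : G
  level : Fin (n + 1)

/-- `(g, i) < (h, j)` if and only if `i < j`; two different elements of the same level are
incomparable. -/
instance QPoset.instPartialOrder (G : Type u) (n : ℕ) : PartialOrder (QPoset G n) where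
  le x y := x = y ∨ x.level < y.level
  le_refl _ := Or.inl rfl
  le_trans _ _ _ hxy hyz := by
    rcases hxy with rfl | hxy
    · exact hyz
    · rcases hyz with rfl | hyz
      · exact Or.inr hxy
      · exact Or.inr (hxy.trans hyz)
  le_antisymm _ _ hxy hyx := by
    rcases hxy with h | hxy
    · exact h
    · rcases hyx with h | hyx
      · exact h.symm
      · exact absurd (hxy.trans hyx) (lt_irrefl _)

instance QPoset.instMulAction (G : Type u) [Group G] (n : ℕ) : MulAction G (QPoset G n) where
  smul g x := ⟨g * x.elt, x.level⟩
  one_smul _ := QPoset.ext (one_mul _) rfl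
  mul_smul _ _ _ := QPoset.ext (mul_assoc _ _ _) rfl

/-- The cross-index of a poset `P` with an action of `G`: the smallest `n` such that there is an
order-preserving `G`-equivariant map from `P` to `Q_n G` (and `⊤` if there is no such `n`). -/
noncomputable def crossIndex (G : Type u) [Group G] (P : Type v) [PartialOrder P] [MulAction G P] :
    ℕ∞ :=
  ⨅ (n : ℕ) (_ : ∃ f : P → QPoset G n, Monotone f ∧ ∀ (g : G) (p : P), f (g • p) = g • f p),
    (n : ℕ∞)

/-! ### The spaces `E_k G` and the mapping index -/

/-- The relation that defines the `(k+1)`-fold join of `Y`: the formal convex combinations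
`t₀ y₀ + ⋯ + t_k y_k` and `t₀' y₀' + ⋯ + t_k' y_k'` are identified when `t = t'` and `yᵢ = yᵢ'`
for all `i` with `tᵢ ≠ 0`. -/
def joinSetoid (Y : Type u) (k : ℕ) :
    Setoid ((Fin (k + 1) → Y) × stdSimplex ℝ (Fin (k + 1))) where
  r a b := a.2 = b.2 ∧ ∀ i, (a.2 : Fin (k + 1) → ℝ) i ≠ 0 → a.1 i = b.1 i
  iseqv :=
    { refl := fun _ => ⟨rfl, fun _ _ => rfl⟩
      symm := fun h => ⟨h.1.symm, fun i hi => (h.2 i (by rw [h.1]; exact hi)).symm⟩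
      trans := fun h h' => ⟨h.1.trans h'.1, fun i hi =>
        (h.2 i hi).trans (h'.2 i (by rw [← h.1]; exact hi))⟩ }

/-- `E_k G`, the `(k+1)`-fold join `G * ⋯ * G` of the topological space `G`. -/
def EG (G : Type u) (k : ℕ) : Type u := Quotient (joinSetoid G k)

/-- The join carries the quotient topology. -/
instance EG.instTopologicalSpace (G : Type u) [TopologicalSpace G] (k : ℕ) :
    TopologicalSpace (EG G k) :=
  inferInstanceAs (TopologicalSpace (Quotient (joinSetoid G k)))

/-- `G` acts diagonally: `g • (t₀ h₀ + ⋯ + t_k h_k) = t₀ (g h₀) + ⋯ + t_k (g h_k)`. -/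
instance EG.instMulAction (G : Type u) [Group G] (k : ℕ) : MulAction G (EG G k) where
  smul g := Quotient.map (fun a => (fun i => g * a.1 i, a.2))
    (fun _ _ h => ⟨h.1, fun i hi => congrArg (g * ·) (h.2 i hi)⟩)
  one_smul x := by
    induction x using Quotient.inductionOn with
    | h a => exact congrArg (Quotient.mk _) (Prod.ext (funext fun i => one_mul _) rfl)
  mul_smul g h x := by
    induction x using Quotient.inductionOn with
    | h a => exact congrArg (Quotient.mk _) (Prod.ext (funext fun i => mul_assoc _ _ _) rfl)

/-- The mapping index of a topological space `X` with an action of `G`: the smallest `k` such that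
there is a continuous `G`-equivariant map from `X` to `E_k G` (and `⊤` if there is no such `k`). -/
noncomputable def mappingIndex (G : Type u) [Group G] [TopologicalSpace G] (X : Type v)
    [TopologicalSpace X] [MulAction G X] : ℕ∞ :=
  ⨅ (k : ℕ) (_ : ∃ f : X → EG G k, Continuous f ∧ ∀ (g : G) (x : X), f (g • x) = g • f x),
    (k : ℕ∞)

/-! ### `G`-simplicial complexes -/

/-- A `G`-simplicial complex: an abstract simplicial complex with an action of `G` on its vertices
that maps simplices to simplices. -/
structure GComplex (G : Type u) [Group G] where
  V : Type v
  [action : MulAction G V]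
  complex : AbstractSimplicialComplex V
  smul_mem : ∀ (g : G) (s : Finset V), s ∈ complex.faces →
    s.map (MulAction.toPerm g).toEmbedding ∈ complex.faces

attribute [instance] GComplex.action

namespace GComplex

variable {G : Type u} [Group G]

/-- The set of all (non-empty) simplices of `K`. -/
def FacePoset (K : GComplex.{u, v} G) : Type v := {s : Finset K.V // s ∈ K.complex.faces}

/-- The simplices are ordered by inclusion. -/
instance (K : GComplex.{u, v} G) : PartialOrder K.FacePoset :=
  inferInstanceAs (PartialOrder {s : Finset K.V // s ∈ K.complex.faces})

/-- The action on simplices induced by the action on vertices. -/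
instance (K : GComplex.{u, v} G) : MulAction G K.FacePoset where
  smul g s := ⟨s.1.map (MulAction.toPerm g).toEmbedding, K.smul_mem g s.1 s.2⟩
  one_smul s := Subtype.ext (by
    change s.1.map (MulAction.toPerm (1 : G)).toEmbedding = s.1
    ext v
    simp)
  mul_smul g h s := Subtype.ext (by
    change s.1.map (MulAction.toPerm (g * h)).toEmbedding =
      (s.1.map (MulAction.toPerm h).toEmbedding).map (MulAction.toPerm g).toEmbedding
    ext v
    simp [mul_smul])

instance (K : GComplex.{u, v} G) :
    CovariantClass G K.FacePoset HSMul.hSMul LE.le where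
  elim g _ _ h := Finset.map_subset_map.2 h

/-- The order complex `Δ(P)` of a `G`-poset `P`: its vertices are the elements of `P` and its
simplices are the non-empty finite chains of `P`. -/
def orderComplex (G : Type u) [Group G] (P : Type v) [PartialOrder P] [MulAction G P]
    [CovariantClass G P HSMul.hSMul LE.le] : GComplex.{u, v} G where
  V := P
  complex :=
    { faces := {s | s.Nonempty ∧ IsChain (· ≤ ·) (s : Set P)}
      isRelLowerSet_faces := fun _ hs =>
        ⟨hs.1, fun _ hts ht => ⟨ht, hs.2.mono (Finset.coe_subset.2 hts)⟩⟩
      singleton_mem := fun p => ⟨Finset.singleton_nonempty p, by simp⟩ }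
  smul_mem := by
    rintro g s ⟨hne, hs⟩
    refine ⟨hne.map, ?_⟩
    intro a ha b hb _
    simp only [Finset.coe_map, Set.mem_image] at ha hb
    obtain ⟨a, ha, rfl⟩ := ha
    obtain ⟨b, hb, rfl⟩ := hb
    rcases hs.total ha hb with h | h
    · exact Or.inl (smul_mono_right g h)
    · exact Or.inr (smul_mono_right g h)

/-- The barycentric subdivision of `K`: its vertices are the simplices of `K` and its simplices are
the non-empty finite chains of simplices of `K`. -/
def sd (K : GComplex.{u, v} G) : GComplex.{u, v} G := orderComplex G K.FacePoset

/-- The geometric realization of `K`, in barycentric coordinates. -/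
def Realization (K : GComplex.{u, v} G) : Type v :=
  {x : K.V → ℝ // (∀ v, 0 ≤ x v) ∧
    ∃ s ∈ K.complex.faces, (∀ v, v ∉ s → x v = 0) ∧ ∑ v ∈ s, x v = 1}

/-- The subspace topology of `ℝ^V`, which is the usual topology of the polyhedron of a complex with
a finite vertex set `V` (the only case in which it is used). -/
instance (K : GComplex.{u, v} G) : TopologicalSpace K.Realization :=
  inferInstanceAs (TopologicalSpace {x : K.V → ℝ // (∀ v, 0 ≤ x v) ∧
    ∃ s ∈ K.complex.faces, (∀ v, v ∉ s → x v = 0) ∧ ∑ v ∈ s, x v = 1})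

/-- `G` acts by extending the action on the vertices affinely to simplices: the barycentric
coordinate of `g • x` at the vertex `v` is that of `x` at `g⁻¹ • v`. -/
instance (K : GComplex.{u, v} G) : MulAction G K.Realization where
  smul g x := ⟨fun v => x.1 (g⁻¹ • v), fun v => x.2.1 _, by
    obtain ⟨s, hs, h0, h1⟩ := x.2.2
    refine ⟨s.map (MulAction.toPerm g).toEmbedding, K.smul_mem g s hs, fun v hv => h0 _ ?_, ?_⟩
    · intro hmem
      exact hv (Finset.mem_map.2 ⟨g⁻¹ • v, hmem, by simp⟩)
    · simpa [Finset.sum_map] using h1⟩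
  one_smul x := Subtype.ext (funext fun v => by
    change x.1 ((1 : G)⁻¹ • v) = x.1 v
    simp)
  mul_smul g h x := Subtype.ext (funext fun v => by
    change x.1 ((g * h)⁻¹ • v) = x.1 (h⁻¹ • g⁻¹ • v)
    rw [mul_inv_rev, mul_smul])

end GComplex

/-!
An order-preserving equivariant map `F(K) → Q_n G` is an equivariant simplicial map from `sd K` to
the order complex of `Q_n G`, whose realization is `E_n G`. Composing its realization with an
equivariant map `|K| → |sd K|` shows that the mapping index of `|K|` is at most the cross-index of
`F(K)`, and likewise with `sd^r K` instead of `K` in the latter. The map to `|sd K|` gives a simplex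
a positive weight at `x` if and only if it is a strict superlevel set of the barycentric coordinates
of `x`; such sets are nested. The mapping index is finite, since a finite free `G`-poset has finite
cross-index: its elements are ranked by the number of elements below them.

The opposite inequality is an equivariant simplicial approximation. Given `|K| → E_k G`, a Lebesgue
number `δ` and freeness yield an equivariant choice, for every point `x` of `|K|`, of a vertex of
`E_k G` whose open star contains the image of the `δ`-ball around `x`. If a simplex has diameter
less than `δ`, then the image of one of its vertices lies in the stars chosen for all of them, so
that these choices form a chain in `Q_k G`; the simplex is sent to the greatest element of this
chain. If the simplices of `K` have at most `N` vertices, the mesh of `sd^r K` is at most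
`(1 - 1/N)^r`, which tends to zero.
-/

universe w

section Preliminaries

variable {G X Y : Type*} [Group G] [MulAction G X] [MulAction G Y]

lemma exists_mulActionHom_forall_rel [IsCancelSMul G X] {R : X → Y → Prop}
    (hR : ∀ x, ∃ y, R x y) (hsmul : ∀ (g : G) x y, R x y → R (g • x) (g • y)) :
    ∃ φ : X →[G] Y, ∀ x, R x (φ x) := by
  choose ρ hρ using hR
  let base : X → X := fun x => (Quotient.mk (MulAction.orbitRel G X) x).out
  have hbase_smul (g : G) (x : X) : base (g • x) = base x :=
    congrArg Quotient.out (Quotient.sound (s := MulAction.orbitRel G X) ⟨g, rfl⟩)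
  have hbase (x : X) : ∃ g : G, g • base x = x :=
    (MulAction.orbitRel G X).symm (Quotient.mk_out (s := MulAction.orbitRel G X) x)
  choose γ hγ using hbase
  have hγ_smul (g : G) (x : X) : γ (g • x) = g * γ x := by
    refine IsCancelSMul.right_cancel _ _ (base x) ?_
    rw [mul_smul, hγ, ← hbase_smul g x, hγ]
  refine ⟨⟨fun x => γ x • ρ (base x), fun g x => ?_⟩, fun x => ?_⟩
  · simp only [hbase_smul, hγ_smul, mul_smul, id]
  · have h := hsmul (γ x) _ _ (hρ (base x))
    rwa [hγ] at h

lemma exists_isGreatest_of_isChain {α : Type*} [Preorder α] {s : Set α}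
    (hs : IsChain (· ≤ ·) s) (hfin : s.Finite) (hne : s.Nonempty) : ∃ m, IsGreatest s m := by
  obtain ⟨m, hm⟩ := hfin.exists_maximal hne
  exact ⟨m, hm.1, fun a ha => (hs.total ha hm.1).elim id (hm.2 ha)⟩

end Preliminaries

section Averages

open scoped BigOperators NNRat

variable {ι E : Type*} [SeminormedAddCommGroup E] [NormedSpace ℝ E] [Module ℚ≥0 E]
  {p : ι → E} {s t : Finset ι} {D : ℝ}

lemma norm_expect_le_expect_norm (s : Finset ι) (p : ι → E) :
    ‖𝔼 i ∈ s, p i‖ ≤ 𝔼 i ∈ s, ‖p i‖ :=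
  Finset.le_expect_of_subadditive norm_zero norm_add_le fun n x => by
    simp only [← NNRat.cast_smul_eq_nnqsmul ℝ, norm_smul, NNRat.cast_inv, NNRat.cast_natCast,
      norm_inv, RCLike.norm_natCast, smul_eq_mul]

lemma norm_sub_expect_le_of_mem {i : ι} (hi : i ∈ t) (hD : ∀ j ∈ t, ‖p i - p j‖ ≤ D) :
    ‖p i - 𝔼 j ∈ t, p j‖ ≤ (1 - (t.card : ℝ)⁻¹) * D := by
  classical
  have hcard : 1 ≤ t.card := Finset.card_pos.2 ⟨i, hi⟩
  have hsum : ∑ j ∈ t, ‖p i - p j‖ ≤ (t.card - 1) * D := by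
    calc ∑ j ∈ t, ‖p i - p j‖
        = ∑ j ∈ t.erase i, ‖p i - p j‖ := (Finset.sum_erase t (by simp)).symm
      _ ≤ (t.erase i).card • D :=
          Finset.sum_le_card_nsmul _ _ _ fun j hj => hD j (Finset.mem_of_mem_erase hj)
      _ = (t.card - 1) * D := by
          rw [Finset.card_erase_of_mem hi, nsmul_eq_mul, Nat.cast_sub hcard, Nat.cast_one]
  calc ‖p i - 𝔼 j ∈ t, p j‖
      = ‖𝔼 j ∈ t, (p i - p j)‖ := by
        rw [Finset.expect_sub_distrib, Finset.expect_const ⟨i, hi⟩]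
    _ ≤ (∑ j ∈ t, ‖p i - p j‖) / t.card := by
        rw [← Finset.expect_eq_sum_div_card]
        exact norm_expect_le_expect_norm _ _
    _ ≤ (t.card - 1) * D / t.card := by gcongr
    _ = (1 - (t.card : ℝ)⁻¹) * D := by field_simp

lemma norm_expect_sub_expect_le (hs : s.Nonempty) (hst : s ⊆ t)
    (hD : ∀ i ∈ t, ∀ j ∈ t, ‖p i - p j‖ ≤ D) :
    ‖𝔼 i ∈ s, p i - 𝔼 j ∈ t, p j‖ ≤ (1 - (t.card : ℝ)⁻¹) * D := by
  rw [← Finset.expect_const hs (𝔼 j ∈ t, p j), ← Finset.expect_sub_distrib]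
  exact (norm_expect_le_expect_norm _ _).trans <| Finset.expect_le hs fun i hi =>
    norm_sub_expect_le_of_mem (hst hi) (hD i (hst hi))

end Averages

section SuperlevelWeight

variable {V : Type*} [Fintype V] [DecidableEq V]

/-- A continuous function of `x ∈ ℝ^V` that is positive if `s` is a strict superlevel set of `x`,
that is, if every value of `x` on `s` exceeds every value of `x` off `s`, and zero otherwise. -/
def superlevelWeight (s : Finset V) (x : V → ℝ) : ℝ :=
  ∏ v ∈ s, ∏ w ∈ sᶜ, max (x v - x w) 0

variable {s t : Finset V} {x : V → ℝ}

lemma superlevelWeight_nonneg (s : Finset V) (x : V → ℝ) : 0 ≤ superlevelWeight s x :=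
  Finset.prod_nonneg fun _ _ => Finset.prod_nonneg fun _ _ => le_max_right _ _

lemma superlevelWeight_ne_zero_iff :
    superlevelWeight s x ≠ 0 ↔ ∀ v ∈ s, ∀ w ∉ s, x w < x v := by
  simp only [superlevelWeight, Finset.prod_ne_zero_iff, Finset.mem_compl, ne_eq,
    max_eq_right_iff, sub_nonpos, not_le]

lemma subset_or_subset_of_superlevelWeight_ne_zero (hs : superlevelWeight s x ≠ 0)
    (ht : superlevelWeight t x ≠ 0) : s ⊆ t ∨ t ⊆ s := by
  rw [superlevelWeight_ne_zero_iff] at hs ht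
  by_contra! h
  obtain ⟨v, hvs, hvt⟩ := Finset.not_subset.1 h.1
  obtain ⟨w, hwt, hws⟩ := Finset.not_subset.1 h.2
  exact lt_asymm (hs v hvs w hws) (ht w hwt v hvt)

lemma superlevelWeight_congr {W : Type*} [Fintype W] [DecidableEq W] (e : V ≃ W) {t : Finset W}
    {y : W → ℝ} (hst : ∀ v, v ∈ s ↔ e v ∈ t) (hxy : ∀ v, x v = y (e v)) :
    superlevelWeight s x = superlevelWeight t y :=
  Finset.prod_equiv e hst fun v _ => Finset.prod_equiv e
    (fun w => by rw [Finset.mem_compl, Finset.mem_compl, hst]) fun w _ => by rw [hxy, hxy]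

lemma continuous_superlevelWeight (s : Finset V) : Continuous (superlevelWeight s) :=
  continuous_finsetProd _ fun _ _ => continuous_finsetProd _ fun _ _ => by fun_prop

end SuperlevelWeight

section Indices

variable {G : Type u} [Group G]

lemma crossIndex_le {P : Type v} [PartialOrder P] [MulAction G P] {n : ℕ} (f : P →[G] QPoset G n)
    (hf : Monotone f) : crossIndex G P ≤ n :=
  iInf₂_le n ⟨f, hf, map_smul f⟩

variable [TopologicalSpace G] {X : Type v} [TopologicalSpace X] [MulAction G X]

lemma mappingIndex_le {k : ℕ} (f : X →[G] EG G k) (hf : Continuous f) : mappingIndex G X ≤ k :=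
  iInf₂_le k ⟨f, hf, map_smul f⟩

lemma mappingIndex_mono {Y : Type w} [TopologicalSpace Y] [MulAction G Y] (f : X →[G] Y)
    (hf : Continuous f) : mappingIndex G X ≤ mappingIndex G Y :=
  le_iInf₂ fun _ ⟨φ, hφ, hφ_smul⟩ =>
    mappingIndex_le (MulActionHom.comp ⟨φ, hφ_smul⟩ f) (hφ.comp hf)

lemma exists_continuous_mulActionHom_of_mappingIndex_le {k : ℕ} (h : mappingIndex G X ≤ k) :
    ∃ m ≤ k, ∃ f : X →[G] EG G m, Continuous f := by
  obtain ⟨m, hm⟩ := iInf_lt_iff.1 (h.trans_lt (ENat.natCast_lt_natCast.2 k.lt_succ_self))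
  obtain ⟨⟨f, hf, hf_smul⟩, hm⟩ := iInf_lt_iff.1 hm
  exact ⟨m, Nat.lt_succ_iff.1 (ENat.natCast_lt_natCast.1 hm), ⟨f, hf_smul⟩, hf⟩

end Indices

namespace QPoset

variable {G : Type u} {n : ℕ}

lemma eq_of_le_of_level_eq {x y : QPoset G n} (h : x ≤ y) (hl : x.level = y.level) : x = y :=
  h.resolve_right hl.not_lt

lemma le_or_le_of_elt_eq {x y : QPoset G n} (h : x.level = y.level → x.elt = y.elt) :
    x ≤ y ∨ y ≤ x := by
  rcases lt_trichotomy x.level y.level with hl | hl | hl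
  · exact Or.inl (Or.inr hl)
  · exact Or.inl (Or.inl (QPoset.ext (h hl) hl))
  · exact Or.inr (Or.inr hl)

lemma injOn_level_of_isChain {C : Set (QPoset G n)} (hC : IsChain (· ≤ ·) C) :
    C.InjOn level := fun _ hx _ hy hl =>
  (hC.total hx hy).elim (eq_of_le_of_level_eq · hl) fun h => (eq_of_le_of_level_eq h hl.symm).symm

instance [Nonempty G] : Nonempty (QPoset G n) := ‹Nonempty G›.map (⟨·, 0⟩)

/-- A chain of `Q_n G` contains at most one element of each level `i`; `labels C i` is its component
in `G`, and an arbitrary element of `G` if there is no such element. -/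
noncomputable def labels [Nonempty G] (C : Set (QPoset G n)) (i : Fin (n + 1)) : G :=
  (Function.invFunOn level C i).elt

lemma labels_level [Nonempty G] {C : Set (QPoset G n)} (hC : IsChain (· ≤ ·) C) {q : QPoset G n}
    (hq : q ∈ C) : labels C q.level = q.elt :=
  congrArg elt ((injOn_level_of_isChain hC).leftInvOn_invFunOn hq)

variable [Group G]

@[simp] lemma level_smul (g : G) (x : QPoset G n) : (g • x).level = x.level := rfl

instance : CovariantClass G (QPoset G n) HSMul.hSMul LE.le where
  elim _ _ _ h := h.imp (congrArg _) id

end QPoset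

section FreePosets

variable {G : Type u} {P : Type v} [Group G] [PartialOrder P] [MulAction G P]
  [CovariantClass G P HSMul.hSMul LE.le]

lemma image_smul_Iio (g : G) (p : P) : (g • ·) '' Set.Iio p = Set.Iio (g • p) :=
  OrderIso.image_Iio
    { MulAction.toPerm g with
      map_rel_iff' := fun {a b} =>
        ⟨fun h => by simpa using smul_mono_right g⁻¹ h, fun h => smul_mono_right g h⟩ } p

lemma crossIndex_ne_top [Finite P] [IsCancelSMul G P] : crossIndex G P ≠ ⊤ := by
  obtain ⟨φ, -⟩ := exists_mulActionHom_forall_rel (G := G) (X := P) (Y := G)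
    (R := fun _ _ => True) (fun _ => ⟨1, trivial⟩) fun _ _ _ _ => trivial
  let rank (p : P) : Fin (Nat.card P + 1) :=
    ⟨(Set.Iio p).ncard, Nat.lt_succ_iff.2 (Set.ncard_le_card _)⟩
  have rank_smul (g : G) (p : P) : rank (g • p) = rank p := Fin.ext <| by
    simp only [rank, ← image_smul_Iio, Set.ncard_image_of_injective _ (MulAction.injective g)]
  have rank_strictMono : StrictMono rank := fun p q hpq =>
    Set.ncard_lt_ncard (Set.Iio_ssubset_Iio hpq)
  refine ne_top_of_le_ne_top (ENat.natCast_ne_top _) <| crossIndex_le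
    ⟨fun p => ⟨φ p, rank p⟩, fun g p => QPoset.ext (map_smul φ g p) (rank_smul g p)⟩ ?_
  exact fun p q hpq => hpq.eq_or_lt.imp (congrArg _) fun h => rank_strictMono h

end FreePosets

namespace EG

variable {G : Type u} {k : ℕ}

/-- The formal convex combination `t₀ l₀ + ⋯ + t_k l_k`. -/
def mk (l : Fin (k + 1) → G) (t : stdSimplex ℝ (Fin (k + 1))) : EG G k :=
  Quotient.mk (joinSetoid G k) (l, t)

lemma exists_eq_mk (x : EG G k) : ∃ l t, x = mk l t :=
  Quotient.inductionOn x fun a => ⟨a.1, a.2, rfl⟩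

lemma mk_congr {l l' : Fin (k + 1) → G} {t : stdSimplex ℝ (Fin (k + 1))}
    (h : ∀ i, t.1 i ≠ 0 → l i = l' i) : mk l t = mk l' t :=
  Quotient.sound ⟨rfl, h⟩

/-- The open star of the vertex `q` of `E_k G`: the points whose coordinate at the level of `q` is
positive and carries the label of `q`. -/
def star (q : QPoset G k) : Set (EG G k) :=
  {x | Quotient.liftOn x
    (fun a => (a.2 : Fin (k + 1) → ℝ) q.level ≠ 0 ∧ a.1 q.level = q.elt)
    fun _ _ h => propext
      ⟨fun ha => ⟨h.1 ▸ ha.1, (h.2 _ ha.1) ▸ ha.2⟩,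
        fun hb => ⟨h.1 ▸ hb.1, (h.2 _ (h.1 ▸ hb.1)) ▸ hb.2⟩⟩}

lemma mk_mem_star {l : Fin (k + 1) → G} {t : stdSimplex ℝ (Fin (k + 1))} {q : QPoset G k} :
    mk l t ∈ star q ↔ t.1 q.level ≠ 0 ∧ l q.level = q.elt :=
  Iff.rfl

lemma exists_mem_star (x : EG G k) : ∃ q, x ∈ star q := by
  obtain ⟨l, t, rfl⟩ := exists_eq_mk x
  obtain ⟨i, -, hi⟩ := Finset.exists_ne_zero_of_sum_ne_zero (t.2.2.trans_ne one_ne_zero)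
  exact ⟨⟨l i, i⟩, mk_mem_star.2 ⟨hi, rfl⟩⟩

lemma le_or_le_of_mem_star {x : EG G k} {q q' : QPoset G k} (hq : x ∈ star q)
    (hq' : x ∈ star q') : q ≤ q' ∨ q' ≤ q := by
  obtain ⟨l, t, rfl⟩ := exists_eq_mk x
  exact QPoset.le_or_le_of_elt_eq fun h => hq.2.symm.trans ((congrArg l h).trans hq'.2)

section Topology

variable [TopologicalSpace G]

lemma continuous_mk (l : Fin (k + 1) → G) : Continuous (mk l) :=
  continuous_quotient_mk'.comp (Continuous.prodMk_right l)

lemma isOpen_star [DiscreteTopology G] (q : QPoset G k) : IsOpen (star q) := by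
  refine isOpen_coinduced.2 ?_
  have hweight : Continuous fun a : (Fin (k + 1) → G) × stdSimplex ℝ (Fin (k + 1)) =>
      (a.2 : Fin (k + 1) → ℝ) q.level :=
    (continuous_apply _).comp (continuous_subtype_val.comp continuous_snd)
  have hlabel : Continuous fun a : (Fin (k + 1) → G) × stdSimplex ℝ (Fin (k + 1)) =>
      a.1 q.level := by fun_prop
  exact (isOpen_ne.preimage hweight).inter ((isOpen_discrete {q.elt}).preimage hlabel)

end Topology

variable [Group G]

lemma smul_mk (g : G) (l : Fin (k + 1) → G) (t : stdSimplex ℝ (Fin (k + 1))) :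
    g • mk l t = mk (fun i => g * l i) t :=
  rfl

lemma smul_mem_star (g : G) {x : EG G k} {q : QPoset G k} (hx : x ∈ star q) :
    g • x ∈ star (g • q) := by
  obtain ⟨l, t, rfl⟩ := exists_eq_mk x
  exact mk_mem_star.2 ⟨hx.1, congrArg (g * ·) hx.2⟩

lemma exists_mulActionHom_ball_subset_preimage_star [TopologicalSpace G] [DiscreteTopology G]
    {X : Type v} [PseudoMetricSpace X] [CompactSpace X] [MulAction G X] [IsIsometricSMul G X]
    [IsCancelSMul G X] (f : X →[G] EG G k) (hf : Continuous f) :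
    ∃ δ > 0, ∃ φ : X →[G] QPoset G k, ∀ x, Metric.ball x δ ⊆ f ⁻¹' star (φ x) := by
  obtain ⟨δ, hδ, hball⟩ := lebesgue_number_lemma_of_metric (c := fun q => f ⁻¹' star q)
    (isCompact_univ (X := X)) (fun q => (isOpen_star q).preimage hf)
    fun x _ => Set.mem_iUnion.2 (exists_mem_star (f x))
  refine ⟨δ, hδ, exists_mulActionHom_forall_rel (fun x => hball x trivial) ?_⟩
  intro g x q hq y hy
  have hy' : g⁻¹ • y ∈ Metric.ball x δ := by
    rwa [← Metric.smul_ball, Set.mem_smul_set_iff_inv_smul_mem] at hy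
  have hstar := smul_mem_star g (hq hy')
  rwa [← map_smul f, smul_inv_smul] at hstar

end EG

namespace GComplex

variable {G : Type u} [Group G]

section Finiteness

instance (K : GComplex.{u, v} G) [Finite K.V] : Finite K.FacePoset :=
  inferInstanceAs (Finite {s : Finset K.V // s ∈ K.complex.faces})

instance (K : GComplex.{u, v} G) [Finite K.V] : Finite K.sd.V :=
  inferInstanceAs (Finite K.FacePoset)

lemma finite_sd_iterate (r : ℕ) (K : GComplex.{u, v} G) [Finite K.V] : Finite (sd^[r] K).V := by
  induction r generalizing K with
  | zero => assumption
  | succ _ ih => exact ih K.sd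

end Finiteness

namespace FacePoset

variable {K : GComplex.{u, v} G}

lemma nonempty (s : K.FacePoset) : s.1.Nonempty :=
  (K.complex.isRelLowerSet_faces s.2).1

lemma mem_smul_iff {g : G} {s : K.FacePoset} {v : K.V} : v ∈ (g • s).1 ↔ g⁻¹ • v ∈ s.1 :=
  Finset.mem_map_equiv

lemma coe_smul (g : G) (s : K.FacePoset) : ((g • s).1 : Set K.V) = (g • ·) '' (s.1 : Set K.V) :=
  Finset.coe_map _ _

end FacePoset

instance isCancelSMul_facePoset_orderComplex {P : Type v} [PartialOrder P] [MulAction G P]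
    [CovariantClass G P HSMul.hSMul LE.le] [IsCancelSMul G P] :
    IsCancelSMul G (orderComplex G P).FacePoset := by
  refine isCancelSMul_iff_eq_one_of_smul_eq.2 fun g s hs => ?_
  obtain ⟨p, hp⟩ := exists_isGreatest_of_isChain s.2.2 s.1.finite_toSet s.nonempty
  have hgp := (smul_mono_right (α := P) g).map_isGreatest hp
  have himage : (g • ·) '' (s.1 : Set (orderComplex G P).V) = s.1 := by
    rw [← FacePoset.coe_smul, hs]
  exact IsCancelSMul.eq_one_of_smul (himage ▸ hgp |>.unique hp)

namespace Realization

variable {K : GComplex.{u, v} G}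

lemma smul_apply (g : G) (x : K.Realization) (v : K.V) : (g • x).1 v = x.1 (g⁻¹ • v) :=
  rfl

lemma smul_apply_smul (g : G) (x : K.Realization) (v : K.V) : (g • x).1 (g • v) = x.1 v := by
  rw [smul_apply, inv_smul_smul]

open Classical in
/-- The smallest simplex of `K` that contains the point `x` of the realization. -/
noncomputable def carrier (x : K.Realization) : K.FacePoset :=
  ⟨{v ∈ x.2.2.choose | x.1 v ≠ 0}, by
    obtain ⟨hs, -, hsum⟩ := x.2.2.choose_spec
    refine (K.complex.isRelLowerSet_faces hs).2 (Finset.filter_subset _ _) ?_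
    obtain ⟨v, hv, hv0⟩ := Finset.exists_ne_zero_of_sum_ne_zero (hsum.trans_ne one_ne_zero)
    exact ⟨v, Finset.mem_filter.2 ⟨hv, hv0⟩⟩⟩

lemma mem_carrier {x : K.Realization} {v : K.V} : v ∈ x.carrier.1 ↔ x.1 v ≠ 0 :=
  Finset.mem_filter.trans <| and_iff_right_of_imp fun hv =>
    by_contra fun hmem => hv (x.2.2.choose_spec.2.1 v hmem)

lemma carrier_le_iff {x : K.Realization} {s : K.FacePoset} :
    x.carrier ≤ s ↔ ∀ v ∉ s.1, x.1 v = 0 :=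
  forall_congr' fun _ => by rw [mem_carrier, not_imp_comm]

lemma carrier_smul (g : G) (x : K.Realization) : (g • x).carrier = g • x.carrier :=
  Subtype.ext <| Finset.ext fun v => by
    rw [FacePoset.mem_smul_iff, mem_carrier, mem_carrier, smul_apply]

instance [IsCancelSMul G K.FacePoset] : IsCancelSMul G K.Realization :=
  isCancelSMul_iff_eq_one_of_smul_eq.2 fun g x hx =>
    IsCancelSMul.eq_one_of_smul ((carrier_smul g x).symm.trans (congrArg carrier hx))

lemma sum_eq_one_of_carrier_le {x : K.Realization} {s : K.FacePoset} (h : x.carrier ≤ s) :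
    ∑ v ∈ s.1, x.1 v = 1 := by
  obtain ⟨-, h0, hsum⟩ := x.2.2.choose_spec
  exact (Finset.sum_congr_of_eq_on_inter (fun v _ hv => h0 v hv)
    (fun v _ hv => carrier_le_iff.1 h v hv) fun _ _ _ => rfl).trans hsum

lemma sum_eq_one [Fintype K.V] (x : K.Realization) : ∑ v, x.1 v = 1 :=
  (Finset.sum_subset (Finset.subset_univ _) fun _ _ hv =>
    not_not.1 (mt mem_carrier.2 hv)).symm.trans (sum_eq_one_of_carrier_le le_rfl)

lemma apply_mem_Icc (x : K.Realization) (v : K.V) : x.1 v ∈ Set.Icc (0 : ℝ) 1 := by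
  refine ⟨x.2.1 v, ?_⟩
  by_cases hv : v ∈ x.carrier.1
  · exact (Finset.single_le_sum (fun w _ => x.2.1 w) hv).trans_eq (sum_eq_one_of_carrier_le le_rfl)
  · rw [not_not.1 (mt mem_carrier.2 hv)]
    exact zero_le_one

lemma isEmbedding_val : Topology.IsEmbedding (X := K.Realization) Subtype.val :=
  .subtypeVal

lemma continuous_apply (v : K.V) : Continuous fun x : K.Realization => x.1 v :=
  (_root_.continuous_apply v).comp isEmbedding_val.continuous

lemma isClosed_carrier_le (s : K.FacePoset) : IsClosed {x : K.Realization | x.carrier ≤ s} := by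
  simp only [carrier_le_iff, Set.ofPred_forall]
  exact isClosed_iInter fun v => isClosed_iInter fun _ =>
    isClosed_eq (continuous_apply v) continuous_const

open Classical in
/-- The point of the realization at the vertex `v`. -/
noncomputable def vertex (v : K.V) : K.Realization :=
  ⟨Pi.single v 1, fun w => by rw [Pi.single_apply]; positivity, {v}, K.complex.singleton_mem v,
    fun _ hw => Pi.single_eq_of_ne (mt Finset.mem_singleton.2 hw) _, by simp⟩

lemma smul_vertex (g : G) (v : K.V) : vertex (g • v) = g • vertex v :=
  Subtype.ext <| funext fun w => by
    rw [smul_apply]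
    simp only [vertex, Pi.single_apply]
    congr 1
    rw [inv_smul_eq_iff]

lemma mem_carrier_vertex {v w : K.V} : w ∈ (vertex v).carrier.1 ↔ w = v :=
  mem_carrier.trans (by simp [vertex, Pi.single_apply])

section Barycentre

open scoped BigOperators

variable {ι : Type*} {s : Finset ι} {p : ι → K.Realization}

/-- The barycentre of finitely many points that lie in a common simplex. -/
noncomputable def barycentre (s : Finset ι) (p : ι → K.Realization) (hs : s.Nonempty)
    (hp : ∃ t : K.FacePoset, ∀ i ∈ s, (p i).carrier ≤ t) : K.Realization := by
  refine ⟨𝔼 i ∈ s, (p i).1, fun v => ?_, ?_⟩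
  · rw [Finset.expect_apply]
    exact Finset.expect_nonneg fun i _ => (p i).2.1 v
  · obtain ⟨t, ht⟩ := hp
    refine ⟨t.1, t.2, fun v hv => ?_, ?_⟩
    · rw [Finset.expect_apply]
      exact Finset.expect_eq_zero fun i hi => carrier_le_iff.1 (ht i hi) v hv
    · simp only [Finset.expect_apply]
      rw [← Finset.expect_sum_comm]
      exact (Finset.expect_congr rfl fun i hi => sum_eq_one_of_carrier_le (ht i hi)).trans
        (Finset.expect_const hs 1)

lemma barycentre_apply (hs : s.Nonempty) (hp : ∃ t : K.FacePoset, ∀ i ∈ s, (p i).carrier ≤ t)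
    (v : K.V) : (barycentre s p hs hp).1 v = 𝔼 i ∈ s, (p i).1 v :=
  Finset.expect_apply _ _ _

lemma carrier_barycentre_le (hs : s.Nonempty)
    (hp : ∃ t : K.FacePoset, ∀ i ∈ s, (p i).carrier ≤ t) {t : K.FacePoset}
    (ht : ∀ i ∈ s, (p i).carrier ≤ t) : (barycentre s p hs hp).carrier ≤ t :=
  carrier_le_iff.2 fun v hv => (barycentre_apply hs hp v).trans <|
    Finset.expect_eq_zero fun i hi => carrier_le_iff.1 (ht i hi) v hv

end Barycentre

section Metric

variable [Fintype K.V]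

/-- The metric induced by the maximum norm on `ℝ^V`. -/
noncomputable instance : MetricSpace K.Realization :=
  isEmbedding_val.comapMetricSpace Subtype.val

lemma dist_le_one (x y : K.Realization) : dist x y ≤ 1 :=
  (dist_pi_le_iff zero_le_one).2 fun v =>
    Real.dist_le_of_mem_Icc_01 (apply_mem_Icc x v) (apply_mem_Icc y v)

instance : IsIsometricSMul G K.Realization where
  isometry_smul g := Isometry.of_dist_eq fun x y =>
    (IsometryEquiv.piCongrLeft' (MulAction.toPerm g)).dist_eq x.1 y.1

end Metric

instance [Finite K.V] : CompactSpace K.Realization := by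
  have := Fintype.ofFinite K.V
  have himage : Subtype.val '' (Set.univ : Set K.Realization) =
      ⋃ s : K.FacePoset, stdSimplex ℝ K.V ∩ {x | ∀ v ∉ s.1, x v = 0} := by
    ext x
    rw [Set.mem_iUnion]
    constructor
    · rintro ⟨(x : K.Realization), -, rfl⟩
      exact ⟨x.carrier, ⟨x.2.1, sum_eq_one x⟩, carrier_le_iff.1 le_rfl⟩
    · rintro ⟨s, hx, hs⟩
      refine ⟨⟨x, hx.1, s.1, s.2, hs, ?_⟩, trivial, rfl⟩
      rw [← hx.2]
      exact Finset.sum_subset (Finset.subset_univ _) fun v _ hv => hs v hv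
  refine ⟨isEmbedding_val.isCompact_iff.2 (himage ▸ ?_)⟩
  refine isCompact_iUnion fun s => (isCompact_stdSimplex ℝ K.V).inter_right ?_
  simp only [Set.ofPred_forall]
  exact isClosed_iInter fun v => isClosed_iInter fun _ =>
    isClosed_eq (_root_.continuous_apply v) continuous_const

end Realization

lemma exists_continuous_mulActionHom_of_weights {X : Type w} [TopologicalSpace X] [MulAction G X]
    (L : GComplex.{u, v} G) [Finite L.V] (f : X → L.V → ℝ) (hcont : ∀ v, Continuous (f · v))
    (hnonneg : ∀ x v, 0 ≤ f x v) (hsmul : ∀ (g : G) x v, f (g • x) (g • v) = f x v)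
    (hface : ∀ x, ∃ s : L.FacePoset, ∀ v, v ∈ s.1 ↔ f x v ≠ 0) :
    ∃ F : X →[G] L.Realization, Continuous F := by
  have := Fintype.ofFinite L.V
  choose s hs using hface
  let total (x : X) : ℝ := ∑ v, f x v
  have total_pos (x : X) : 0 < total x := by
    obtain ⟨v, hv⟩ := (s x).nonempty
    exact Finset.sum_pos' (fun w _ => hnonneg x w)
      ⟨v, Finset.mem_univ v, (hnonneg x v).lt_of_ne' ((hs x v).1 hv)⟩
  have total_smul (g : G) (x : X) : total (g • x) = total x :=
    (Equiv.sum_comp (MulAction.toPerm g) (f (g • x))).symm.trans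
      (Finset.sum_congr rfl fun v _ => hsmul g x v)
  have sum_eq_total (x : X) : ∑ v ∈ (s x).1, f x v = total x :=
    Finset.sum_subset (Finset.subset_univ _) fun v _ hv => not_not.1 (mt (hs x v).2 hv)
  let F (x : X) : L.Realization :=
    ⟨fun v => f x v / total x, fun v => div_nonneg (hnonneg x v) (total_pos x).le, (s x).1, (s x).2,
      fun v hv => div_eq_zero_iff.2 (Or.inl (not_not.1 (mt (hs x v).2 hv))),
      by rw [← Finset.sum_div, sum_eq_total, div_self (total_pos x).ne']⟩
  refine ⟨⟨F, fun g x => Subtype.ext <| funext fun v => ?_⟩, ?_⟩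
  · change f (g • x) v / total (g • x) = f x (g⁻¹ • v) / total x
    rw [total_smul, ← hsmul g x, smul_inv_smul]
  · refine Continuous.subtype_mk (continuous_pi fun v => ?_) _
    exact (hcont v).div (continuous_finsetSum _ fun w _ => hcont w) fun x => (total_pos x).ne'

lemma exists_continuous_mulActionHom_sd (K : GComplex.{u, v} G) [Finite K.V] :
    ∃ f : K.Realization →[G] K.sd.Realization, Continuous f := by
  classical
  have := Fintype.ofFinite K.V
  refine exists_continuous_mulActionHom_of_weights K.sd
    (fun x (s : K.FacePoset) => superlevelWeight s.1 x.1)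
    (fun s => (continuous_superlevelWeight s.1).comp continuous_subtype_val)
    (fun x s => superlevelWeight_nonneg s.1 x.1) (fun g x s => ?_) fun x => ?_
  · refine (superlevelWeight_congr (MulAction.toPerm g) (fun v => ?_) fun v => ?_).symm
    · exact (Finset.mem_map' (MulAction.toPerm g).toEmbedding).symm
    · exact (Realization.smul_apply_smul g x v).symm
  · let C : Set K.FacePoset := {s | superlevelWeight s.1 x.1 ≠ 0}
    have hC : IsChain (· ≤ ·) C := fun s hs t ht _ =>
      subset_or_subset_of_superlevelWeight_ne_zero hs ht
    have hcarrier : x.carrier ∈ C := superlevelWeight_ne_zero_iff.2 fun v hv w hw =>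
      (not_not.1 (mt Realization.mem_carrier.2 hw)).trans_lt
        ((x.2.1 v).lt_of_ne' (Realization.mem_carrier.1 hv))
    refine ⟨⟨C.toFinite.toFinset, ⟨x.carrier, C.toFinite.mem_toFinset.2 hcarrier⟩, ?_⟩,
      fun s => C.toFinite.mem_toFinset⟩
    rwa [Set.Finite.coe_toFinset]

lemma mappingIndex_realization_le_sd_iterate [TopologicalSpace G] (r : ℕ) (K : GComplex.{u, v} G)
    [Finite K.V] : mappingIndex G K.Realization ≤ mappingIndex G (sd^[r] K).Realization := by
  induction r generalizing K with
  | zero => rfl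
  | succ r ih =>
    obtain ⟨f, hf⟩ := exists_continuous_mulActionHom_sd K
    exact (mappingIndex_mono f hf).trans (ih K.sd)

section MapsFacesToChains

variable {K : GComplex.{u, v} G}

/-- A vertex map `ψ` with this property is a simplicial map from `K` to the order complex of `Q`. -/
def MapsFacesToChains (K : GComplex.{u, v} G) {Q : Type w} [LE Q] (ψ : K.V → Q) : Prop :=
  ∀ s : K.FacePoset, IsChain (· ≤ ·) (ψ '' s.1)

lemma mapsFacesToChains_orderComplex {P : Type v} {Q : Type w} [PartialOrder P] [MulAction G P]
    [CovariantClass G P HSMul.hSMul LE.le] [Preorder Q] {f : P → Q} (hf : Monotone f) :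
    (orderComplex G P).MapsFacesToChains f := fun s =>
  hf.isChain_image s.2.2

lemma MapsFacesToChains.exists_monotone_mulActionHom {Q : Type w} [PartialOrder Q] [MulAction G Q]
    [CovariantClass G Q HSMul.hSMul LE.le] {ψ : K.V →[G] Q} (hψ : K.MapsFacesToChains ψ) :
    ∃ f : K.FacePoset →[G] Q, Monotone f := by
  have hgreatest (s : K.FacePoset) : ∃ q, IsGreatest (ψ '' s.1) q :=
    exists_isGreatest_of_isChain (hψ s) (s.1.finite_toSet.image ψ) (s.nonempty.to_set.image ψ)
  choose top htop using hgreatest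
  refine ⟨⟨top, fun g s => (htop _).unique ?_⟩, fun s t hst =>
    (htop s).mono (htop t) (Set.image_mono hst)⟩
  have h := (smul_mono_right (α := Q) g).map_isGreatest (htop s)
  rwa [Set.image_image, ← Set.image_congr fun v _ => map_smul ψ g v,
    ← Set.image_image ψ, ← FacePoset.coe_smul] at h

variable {n : ℕ}

section JoinMap

variable [Fintype K.V] {ψ : K.V → QPoset G n} {x : K.Realization}

/-- The join coordinates of the image of `x` under the map `|K| → E_n G` that extends the vertex
map `ψ` affinely: the weights of the vertices of each level are added up. -/
def levelWeights (ψ : K.V → QPoset G n) (x : K.Realization) : stdSimplex ℝ (Fin (n + 1)) :=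
  ⟨fun i => ∑ v with (ψ v).level = i, x.1 v, fun _ => Finset.sum_nonneg fun v _ => x.2.1 v,
    (Finset.sum_fiberwise _ _ _).trans (Realization.sum_eq_one x)⟩

lemma exists_mem_carrier_of_levelWeights_ne_zero {i : Fin (n + 1)}
    (hi : (levelWeights ψ x).1 i ≠ 0) : ∃ v ∈ x.carrier.1, (ψ v).level = i := by
  obtain ⟨v, hv, hxv⟩ := Finset.exists_ne_zero_of_sum_ne_zero hi
  exact ⟨v, Realization.mem_carrier.2 hxv, (Finset.mem_filter.1 hv).2⟩

lemma continuous_levelWeights (ψ : K.V → QPoset G n) : Continuous (levelWeights ψ) :=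
  Continuous.subtype_mk (continuous_pi fun _ =>
    continuous_finsetSum _ fun v _ => Realization.continuous_apply v) _

lemma levelWeights_smul (ψ : K.V →[G] QPoset G n) (g : G) (x : K.Realization) :
    levelWeights ψ (g • x) = levelWeights ψ x := by
  refine Subtype.ext <| funext fun i => (Finset.sum_equiv (MulAction.toPerm g) ?_ ?_).symm
  · simp [map_smul]
  · exact fun v _ => (Realization.smul_apply_smul g x v).symm

/-- The map `|K| → E_n G` that extends the vertex map `ψ` affinely. -/
noncomputable def joinMap (ψ : K.V → QPoset G n) (x : K.Realization) : EG G n :=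
  EG.mk (QPoset.labels (ψ '' x.carrier.1)) (levelWeights ψ x)

lemma joinMap_eq_mk (hψ : K.MapsFacesToChains ψ) {s : K.FacePoset} (hs : x.carrier ≤ s) :
    joinMap ψ x = EG.mk (QPoset.labels (ψ '' s.1)) (levelWeights ψ x) :=
  EG.mk_congr fun i hi => by
    obtain ⟨v, hv, rfl⟩ := exists_mem_carrier_of_levelWeights_ne_zero hi
    rw [QPoset.labels_level (hψ _) (Set.mem_image_of_mem ψ hv),
      QPoset.labels_level (hψ _) (Set.mem_image_of_mem ψ (hs hv))]

lemma joinMap_smul {ψ : K.V →[G] QPoset G n} (hψ : K.MapsFacesToChains ψ) (g : G)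
    (x : K.Realization) : joinMap ψ (g • x) = g • joinMap ψ x := by
  rw [joinMap, joinMap, levelWeights_smul, EG.smul_mk]
  refine EG.mk_congr fun i hi => ?_
  obtain ⟨v, hv, rfl⟩ := exists_mem_carrier_of_levelWeights_ne_zero hi
  have hgv : g • ψ v ∈ ψ '' (g • x).carrier.1 :=
    ⟨g • v, Realization.mem_carrier.2 <|
      (Realization.smul_apply_smul g x v).trans_ne (Realization.mem_carrier.1 hv), map_smul ψ g v⟩
  rw [QPoset.labels_level (hψ _) (Set.mem_image_of_mem ψ hv)]
  exact QPoset.labels_level (hψ _) hgv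

lemma continuous_joinMap [TopologicalSpace G] (hψ : K.MapsFacesToChains ψ) :
    Continuous (joinMap ψ) :=
  (locallyFinite_of_finite fun s : K.FacePoset => {x : K.Realization | x.carrier ≤ s}).continuous
    (Set.eq_univ_of_forall fun x => Set.mem_iUnion.2 ⟨x.carrier, le_refl x.carrier⟩)
    Realization.isClosed_carrier_le fun _ =>
      ((EG.continuous_mk _).comp (continuous_levelWeights ψ)).continuousOn.congr
        fun _ hx => joinMap_eq_mk hψ hx

end JoinMap

lemma mappingIndex_realization_le [TopologicalSpace G] [Finite K.V] (ψ : K.V →[G] QPoset G n)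
    (hψ : K.MapsFacesToChains ψ) : mappingIndex G K.Realization ≤ n :=
  have := Fintype.ofFinite K.V
  mappingIndex_le ⟨joinMap ψ, joinMap_smul hψ⟩ (continuous_joinMap hψ)

end MapsFacesToChains

lemma mappingIndex_orderComplex_le_crossIndex [TopologicalSpace G] {P : Type v} [PartialOrder P]
    [Finite P] [MulAction G P] [CovariantClass G P HSMul.hSMul LE.le] :
    mappingIndex G (orderComplex G P).Realization ≤ crossIndex G P :=
  have : Finite (orderComplex G P).V := ‹Finite P›
  le_iInf₂ fun _ ⟨f, hf, hf_smul⟩ =>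
    mappingIndex_realization_le ⟨f, hf_smul⟩ (mapsFacesToChains_orderComplex hf)

lemma mappingIndex_realization_le_crossIndex_facePoset [TopologicalSpace G]
    (K : GComplex.{u, v} G) [Finite K.V] :
    mappingIndex G K.Realization ≤ crossIndex G K.FacePoset :=
  (mappingIndex_realization_le_sd_iterate 1 K).trans mappingIndex_orderComplex_le_crossIndex

section FineSubdivisions

variable {L : GComplex.{u, w} G} {K : GComplex.{u, v} G}

/-- The restriction to vertices of an equivariant map `|L| → |K|` that is affine on each simplex of
`L`: the images of the vertices of a simplex of `L` lie in a common simplex of `K`. -/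
structure AffineVertexMap (L : GComplex.{u, w} G) (K : GComplex.{u, v} G) where
  toHom : L.V →[G] K.Realization
  exists_face : ∀ s : L.FacePoset, ∃ t : K.FacePoset, ∀ v ∈ s.1, (toHom v).carrier ≤ t

namespace AffineVertexMap

/-- The identity map of `|K|`. -/
noncomputable def refl (K : GComplex.{u, v} G) : AffineVertexMap K K where
  toHom := ⟨Realization.vertex, Realization.smul_vertex⟩
  exists_face s := ⟨s, fun _ hv _ hw => (Realization.mem_carrier_vertex.1 hw).symm ▸ hv⟩

/-- The same map of realizations, seen on the vertices of the subdivision of `L`: the simplex `s`,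
as a vertex of `sd L`, stands for the barycentre of `s`. -/
noncomputable def subdivide (J : AffineVertexMap L K) : AffineVertexMap L.sd K where
  toHom.toFun (s : L.FacePoset) :=
    Realization.barycentre s.1 J.toHom s.nonempty (J.exists_face s)
  toHom.map_smul' g (s : L.FacePoset) := Subtype.ext <| funext fun v => by
    rw [id, Realization.smul_apply, Realization.barycentre_apply, Realization.barycentre_apply]
    refine (Finset.expect_equiv (MulAction.toPerm g) (fun w => ?_) fun w _ => ?_).symm
    · exact (Finset.mem_map' (MulAction.toPerm g).toEmbedding).symm
    · exact congrFun (congrArg Subtype.val (map_smul J.toHom g w)).symm v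
  exists_face c := by
    obtain ⟨s, -, hmax⟩ := exists_isGreatest_of_isChain c.2.2 c.1.finite_toSet c.nonempty
    obtain ⟨t, ht⟩ := J.exists_face s
    exact ⟨t, fun (a : L.FacePoset) ha =>
      Realization.carrier_barycentre_le a.nonempty (J.exists_face a) fun v hv => ht v (hmax ha hv)⟩

variable [Fintype K.V] {J : AffineVertexMap L K} {D : ℝ} {N : ℕ}

/-- The images of the simplices of `L` have diameter at most `D`. -/
def MeshLE (J : AffineVertexMap L K) (D : ℝ) : Prop :=
  ∀ s : L.FacePoset, ∀ v ∈ s.1, ∀ w ∈ s.1, dist (J.toHom v) (J.toHom w) ≤ D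

lemma MeshLE.dist_subdivide_le (hJ : J.MeshLE D) (hN : ∀ s : L.FacePoset, s.1.card ≤ N)
    {s t : L.FacePoset} (hst : s ≤ t) :
    dist (J.subdivide.toHom s) (J.subdivide.toHom t) ≤ (1 - (N : ℝ)⁻¹) * D := by
  obtain ⟨v, hv⟩ := t.nonempty
  have hD : 0 ≤ D := dist_nonneg.trans (hJ t v hv v hv)
  have hcard : (0 : ℝ) < t.1.card := Nat.cast_pos.2 t.nonempty.card_pos
  calc dist (J.subdivide.toHom s) (J.subdivide.toHom t)
      ≤ (1 - (t.1.card : ℝ)⁻¹) * D :=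
        norm_expect_sub_expect_le (p := fun v => (J.toHom v).1) s.nonempty hst (hJ t)
    _ ≤ (1 - (N : ℝ)⁻¹) * D := by
        gcongr
        exact hN t

lemma MeshLE.subdivide (hJ : J.MeshLE D) (hN : ∀ s : L.FacePoset, s.1.card ≤ N) :
    J.subdivide.MeshLE ((1 - (N : ℝ)⁻¹) * D) := fun c s hs t ht => by
  rcases c.2.2.total hs ht with h | h
  · exact hJ.dist_subdivide_le hN h
  · rw [dist_comm]
    exact hJ.dist_subdivide_le hN h

end AffineVertexMap

lemma card_le_of_facePoset_sd {N : ℕ} (hN : ∀ s : L.FacePoset, s.1.card ≤ N)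
    (c : L.sd.FacePoset) : c.1.card ≤ N := by
  have hinj : Set.InjOn (fun s : L.FacePoset => s.1.card) (c.1 : Set L.sd.V) :=
    fun s hs t ht hcard => (c.2.2.total hs ht).elim
      (fun h => Subtype.ext (Finset.eq_of_subset_of_card_le h hcard.ge))
      fun h => (Subtype.ext (Finset.eq_of_subset_of_card_le h hcard.le)).symm
  calc c.1.card ≤ (Finset.Icc 1 N).card := Finset.card_le_card_of_injOn _
        (fun s _ => Finset.mem_Icc.2 ⟨s.nonempty.card_pos, hN s⟩) hinj
    _ = N := Nat.card_Icc 1 N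

lemma AffineVertexMap.MeshLE.exists_sd_iterate [Fintype K.V] {N : ℕ} (r : ℕ)
    {J : AffineVertexMap L K} {D : ℝ} (hJ : J.MeshLE D) (hN : ∀ s : L.FacePoset, s.1.card ≤ N) :
    ∃ J' : AffineVertexMap (sd^[r] L) K, J'.MeshLE ((1 - (N : ℝ)⁻¹) ^ r * D) := by
  induction r generalizing L D with
  | zero => exact ⟨J, by rwa [pow_zero, one_mul]⟩
  | succ r ih =>
    obtain ⟨J', hJ'⟩ := ih (hJ.subdivide hN) (card_le_of_facePoset_sd hN)
    exact ⟨J', by rwa [pow_succ, mul_assoc]⟩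

lemma eventually_exists_meshLE_sd_iterate (K : GComplex.{u, v} G) [Fintype K.V] {δ : ℝ}
    (hδ : 0 < δ) :
    ∀ᶠ r in Filter.atTop, ∃ J : AffineVertexMap (sd^[r] K) K, ∃ D < δ, J.MeshLE D := by
  let N := Fintype.card K.V + 1
  have hN (s : K.FacePoset) : s.1.card ≤ N := (Finset.card_le_univ s.1).trans (Nat.le_succ _)
  have hρ₀ : 0 ≤ 1 - (N : ℝ)⁻¹ := sub_nonneg.2 (Nat.cast_inv_le_one N)
  have hρ₁ : 1 - (N : ℝ)⁻¹ < 1 := sub_lt_self _ (inv_pos.2 (Nat.cast_pos.2 (Nat.succ_pos _)))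
  have hrefl : (AffineVertexMap.refl K).MeshLE 1 := fun _ _ _ _ _ => Realization.dist_le_one _ _
  filter_upwards [(tendsto_pow_atTop_nhds_zero_of_lt_one hρ₀ hρ₁).eventually_lt_const hδ] with r hr
  obtain ⟨J, hJ⟩ := hrefl.exists_sd_iterate r hN
  exact ⟨J, _, (mul_one _).trans_lt hr, hJ⟩

end FineSubdivisions

lemma eventually_crossIndex_sd_iterate_le [TopologicalSpace G] [DiscreteTopology G]
    (K : GComplex.{u, v} G) [Finite K.V] [IsCancelSMul G K.FacePoset] {k : ℕ}
    (f : K.Realization →[G] EG G k) (hf : Continuous f) :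
    ∀ᶠ r in Filter.atTop, crossIndex G (sd^[r] K).FacePoset ≤ k := by
  have := Fintype.ofFinite K.V
  obtain ⟨δ, hδ, φ, hφ⟩ := EG.exists_mulActionHom_ball_subset_preimage_star f hf
  filter_upwards [eventually_exists_meshLE_sd_iterate K hδ] with r ⟨J, D, hD, hJ⟩
  have hψ : (sd^[r] K).MapsFacesToChains (φ.comp J.toHom) := by
    rintro s _ ⟨v, hv, rfl⟩ _ ⟨w, hw, rfl⟩ -
    exact EG.le_or_le_of_mem_star (hφ _ (Metric.mem_ball_self hδ))
      (hφ _ (Metric.mem_ball.2 ((hJ s v hv w hw).trans_lt hD)))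
  obtain ⟨g, hg⟩ := hψ.exists_monotone_mulActionHom
  exact crossIndex_le g hg

lemma eventually_crossIndex_sd_iterate_le_mappingIndex [TopologicalSpace G] [DiscreteTopology G]
    (K : GComplex.{u, v} G) [Finite K.V] [IsCancelSMul G K.FacePoset] :
    ∀ᶠ r in Filter.atTop,
      crossIndex G (sd^[r] K).FacePoset ≤ mappingIndex G K.Realization := by
  rcases eq_or_ne (mappingIndex G K.Realization) ⊤ with h | h
  · simp only [h, le_top, Filter.eventually_true]
  · obtain ⟨k, hk⟩ := ENat.ne_top_iff_exists.1 h
    obtain ⟨m, hm, f, hf⟩ := exists_continuous_mulActionHom_of_mappingIndex_le hk.ge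
    filter_upwards [eventually_crossIndex_sd_iterate_le K f hf] with r hr
    exact hr.trans (hk ▸ ENat.natCast_le_natCast.2 hm)

end GComplex

theorem mainTheorem6_general {G : Type u} [Group G] [TopologicalSpace G] [DiscreteTopology G]
    (K : GComplex.{u, v} G) [Finite K.V] [IsCancelSMul G K.FacePoset] :
    mappingIndex G K.Realization ≠ ⊤ ∧
    ∃ r₀ : ℕ, ∀ r : ℕ, r₀ ≤ r →
      crossIndex G (GComplex.sd^[r] K).FacePoset = mappingIndex G K.Realization := by
  refine ⟨ne_top_of_le_ne_top crossIndex_ne_top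
    K.mappingIndex_realization_le_crossIndex_facePoset, Filter.eventually_atTop.1 ?_⟩
  filter_upwards [K.eventually_crossIndex_sd_iterate_le_mappingIndex] with r hr
  have := GComplex.finite_sd_iterate r K
  exact hr.antisymm ((GComplex.mappingIndex_realization_le_sd_iterate r K).trans
    (GComplex.sd^[r] K).mappingIndex_realization_le_crossIndex_facePoset)

theorem mainTheorem6 (G : Type u) [Group G] [Finite G] [Nontrivial G]
    [TopologicalSpace G] [DiscreteTopology G]
    (P : Type v) [PartialOrder P] [Finite P] [MulAction G P]
    [CovariantClass G P HSMul.hSMul LE.le]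
    (hfree : ∀ (g : G) (p : P), g • p = p → g = 1) :
    mappingIndex G (GComplex.orderComplex G P).Realization ≠ ⊤ ∧
    ∃ r₀ : ℕ, ∀ r : ℕ, r₀ ≤ r →
      crossIndex G (GComplex.sd^[r] (GComplex.orderComplex G P)).FacePoset =
        mappingIndex G (GComplex.orderComplex G P).Realization := by
  have : IsCancelSMul G P := isCancelSMul_iff_eq_one_of_smul_eq.2 hfree
  have : Finite (GComplex.orderComplex G P).V := ‹Finite P›
  exact mainTheorem6_general (GComplex.orderComplex G P)
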